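/- For $\kappa\in\mathbb{R}$ let $$\mathrm{sn}_\kappa(t)=\begin{cases}\frac{1}{\sqrt{\kappa}}\sin(\sqrt{\kappa}\,t)&\kappa>0\\ t&\kappa=0\\ \frac{1}{\sqrt{|\kappa|}}\sinh(\sqrt{|\kappa|}\,t)&\kappa<0\end{cases}\qquad \mathrm{cs}_\kappa(t)=\begin{cases}\cos(\sqrt{\kappa}\,t)&\kappa>0\\ 1&\kappa=0\\ \cosh(\sqrt{|\kappa|}\,t)&\kappa<0.\end{cases}$$ Let $(M,g)$ be a smooth finite-dimensional semi-Riemannian manifold (without boundary) with Levi-Civita connection $\nabla$ and curvature tensor $R(X,Y)Z=\nabla_X\nabla_YZ-\nabla_Y\nabla_XZ-\nabla_{[X,Y]}Z$. Let $\kappa\in\mathbb{R}$ and let $A$ be a smooth field of $g$-symmetric endomorphisms of $TM$ satisfying the Codazzi equation $$(\nabla_XA)Y=(\nabla_YA)X$$ and the Gauss equation $$R(X,Y)Z=\langle A(Y),Z\rangle A(X)-\langle A(X),Z\rangle A(Y)+\kappa\,(\langle Y,Z\rangle X-\langle X,Z\rangle Y)$$ for all $X,Y,Z\in T_pM$, $p\in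 M$, where $\langle\cdot,\cdot\rangle=g$. Put $$g_t(X,Y)=g\big((\mathrm{cs}_\kappa(t)\,\mathrm{id}-\mathrm{sn}_\kappa(t)A)^2X,\,Y\big),$$ and let $D\subseteq\mathbb{R}\times M$ be the set of points $(t,p)$ at which the symmetric bilinear form $dt^2+g_t$ is nondegenerate. Then $D$ is an open neighbourhood of $\{0\}\times M$ in $\mathbb{R}\times M$, and on $D$ the form $dt^2+g_t$ is a smooth semi-Riemannian metric of constant sectional curvature $\kappa$: every nondegenerate tangent plane at a point of $D$ has sectional curvature $\kappa$, and the curvature tensor $R^D$ of this metric satisfies $R^D(X,Y)Z=\kappa\,(\langle Y,Z\rangle X-\langle X,Z\rangle Y)$ on $D$, where now $\langle\cdot,\cdot\rangle=dt^2+g_t$. In particular this holds on $I\times M$ for every open interval $I$ with $I\times M\subseteq D$. -/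

import Mathlib

open scoped Manifold ContDiff Topology

noncomputable section

/-! ## Generalized sine and cosine -/

/-- The generalized sine function `sn_κ`. -/
def genSin (κ t : ℝ) : ℝ :=
  if 0 < κ then Real.sin (√κ * t) / √κ
  else if κ = 0 then t
  else Real.sinh (√|κ| * t) / √|κ|

/-- The generalized cosine function `cs_κ`. -/
def genCos (κ t : ℝ) : ℝ :=
  if 0 < κ then Real.cos (√κ * t)
  else if κ = 0 then 1
  else Real.cosh (√|κ| * t)

/-! ## Pullback of bilinear forms -/

/-- The bilinear form `(u, v) ↦ b (L u) (L v)`. -/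
def bilinPullback {V W : Type*} [AddCommGroup V] [Module ℝ V] [TopologicalSpace V]
    [AddCommGroup W] [Module ℝ W] [TopologicalSpace W]
    (b : W →L[ℝ] W →L[ℝ] ℝ) (L : V →L[ℝ] W) : V →L[ℝ] V →L[ℝ] ℝ :=
  (ContinuousLinearMap.precomp ℝ L).comp (b.comp L)

/-! ## Levi-Civita connection and curvature on open subsets of a vector space

`G y` is the value at `y` of a field of bilinear forms on a finite-dimensional space `E`.
All formulas below are for constant (coordinate) vector fields `u`, `v`, `w`, whose Lie
brackets vanish. -/

section Coordinates

variable {E : Type*} [NormedAddCommGroup E] [NormedSpace ℝ E]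

/-- The covector `G (∇_u v, ·)` given by the Koszul formula: it maps `w` to
`(∂_u G(v, w) + ∂_v G(u, w) - ∂_w G(u, v)) / 2`. -/
def coordKoszul (G : E → E →L[ℝ] E →L[ℝ] ℝ) (y u v : E) : E →L[ℝ] ℝ :=
  (1 / 2 : ℝ) • (fderiv ℝ G y u v + fderiv ℝ G y v u - ((fderiv ℝ G y).flip u).flip v)

/-- The Christoffel symbol `Γ_y(u, v)`, i.e. `∇_u v` at `y` for the Levi-Civita connection of `G`:
the vector dual to the Koszul covector with respect to `G y`. -/
def coordChristoffel (G : E → E →L[ℝ] E →L[ℝ] ℝ) (y u v : E) : E :=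
  (G y).inverse (coordKoszul G y u v)

/-- The curvature `R(u, v) w = ∇_u ∇_v w - ∇_v ∇_u w` at `y` of the Levi-Civita connection
of `G`. -/
def coordCurvature (G : E → E →L[ℝ] E →L[ℝ] ℝ) (y u v w : E) : E :=
  fderiv ℝ (fun z => coordChristoffel G z v w) y u
    - fderiv ℝ (fun z => coordChristoffel G z u w) y v
    + coordChristoffel G y u (coordChristoffel G y v w)
    - coordChristoffel G y v (coordChristoffel G y u w)

/-- The covariant derivative `(∇_u A) v = ∇_u (A v) - A (∇_u v)` at `y` of an endomorphism
field `A`. -/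
def coordCovDerivEndo (G : E → E →L[ℝ] E →L[ℝ] ℝ) (A : E → E →L[ℝ] E) (y u v : E) : E :=
  fderiv ℝ A y u v + coordChristoffel G y u (A y v) - A y (coordChristoffel G y u v)

end Coordinates

/-! ## Tensor fields, metrics and curvature on manifolds -/

section Manifold

variable {E : Type*} [NormedAddCommGroup E] [NormedSpace ℝ E]
  {H : Type*} [TopologicalSpace H] (I : ModelWithCorners ℝ E H)
  {M : Type*} [TopologicalSpace M] [ChartedSpace H M]

/-- A field of bilinear forms on the tangent spaces of `M`. -/
abbrev BilinField (M : Type*) [TopologicalSpace M] [ChartedSpace H M] : Type _ :=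
  ∀ p : M, TangentSpace I p →L[ℝ] TangentSpace I p →L[ℝ] ℝ

/-- A field of endomorphisms of the tangent spaces of `M`. -/
abbrev EndoField (M : Type*) [TopologicalSpace M] [ChartedSpace H M] : Type _ :=
  ∀ p : M, TangentSpace I p →L[ℝ] TangentSpace I p

variable {I}

/-- The points at which a field of bilinear forms is nondegenerate. -/
def BilinField.nondegenerateLocus (g : BilinField I M) : Set M :=
  {p | ∀ v : TangentSpace I p, (∀ w : TangentSpace I p, g p v w = 0) → v = 0}

/-- `g` is a smooth semi-Riemannian metric on `s`. -/
structure IsSemiRiemannianMetricOn [IsManifold I 1 M] (g : BilinField I M) (s : Set M) : Prop where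
  symm : ∀ p ∈ s, ∀ v w : TangentSpace I p, g p v w = g p w v
  nondegenerate : s ⊆ g.nondegenerateLocus
  smooth : ContMDiffOn I (I.prod 𝓘(ℝ, E →L[ℝ] E →L[ℝ] ℝ)) ∞
    (fun p => (Bundle.TotalSpace.mk' (E →L[ℝ] E →L[ℝ] ℝ) p (g p) :
      Bundle.TotalSpace (E →L[ℝ] E →L[ℝ] ℝ)
        (fun p : M => TangentSpace I p →L[ℝ] TangentSpace I p →L[ℝ] ℝ))) s

/-- `A` is a smooth field of endomorphisms, symmetric with respect to `g`. -/
structure IsSymmetricEndoField [IsManifold I 1 M] (g : BilinField I M) (A : EndoField I M) :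
    Prop where
  symm : ∀ (p : M) (v w : TangentSpace I p), g p (A p v) w = g p v (A p w)
  smooth : ContMDiff I (I.prod 𝓘(ℝ, E →L[ℝ] E)) ∞
    (fun p => (Bundle.TotalSpace.mk' (E →L[ℝ] E) p (A p) :
      Bundle.TotalSpace (E →L[ℝ] E)
        (fun p : M => TangentSpace I p →L[ℝ] TangentSpace I p)))

variable (I) in
/-- The differential at `p` of the chart `e`. -/
def chartDiff (e : OpenPartialHomeomorph M H) (p : M) : TangentSpace I p →L[ℝ] E :=
  mfderiv I 𝓘(ℝ, E) (e.extend I) p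

variable (I) in
/-- The differential at `y` of the inverse of the chart `e`. -/
def chartSymmDiff (e : OpenPartialHomeomorph M H) (y : E) :
    E →L[ℝ] TangentSpace I ((e.extend I).symm y) :=
  mfderiv 𝓘(ℝ, E) I (e.extend I).symm y

/-- The field `g` of bilinear forms in the chart `e`. -/
def BilinField.inChart (g : BilinField I M) (e : OpenPartialHomeomorph M H) :
    E → E →L[ℝ] E →L[ℝ] ℝ :=
  fun y => bilinPullback (g ((e.extend I).symm y)) (chartSymmDiff I e y)

/-- The endomorphism field `A` in the chart `e`. -/
def EndoField.inChart (A : EndoField I M) (e : OpenPartialHomeomorph M H) : E → E →L[ℝ] E :=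
  fun y => (chartDiff I e ((e.extend I).symm y)).comp
    ((A ((e.extend I).symm y)).comp (chartSymmDiff I e y))

variable (I) in
/-- The coordinate vector `x` at the point `p`, viewed as a tangent vector through the chart `e`:
the inverse of `chartDiff I e p` when `p` is in the source of `e`. -/
def chartLift (e : OpenPartialHomeomorph M H) (p : M) (x : E) : TangentSpace I p :=
  (chartDiff I e p).inverse x

/-- The Riemann curvature tensor `R(u, v) w` of `g` at `p`, computed in the chart `e`. -/
def riemannCurvature (g : BilinField I M) (e : OpenPartialHomeomorph M H) (p : M)
    (u v w : TangentSpace I p) : TangentSpace I p :=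
  chartLift I e p (coordCurvature (g.inChart e) (e.extend I p)
    (chartDiff I e p u) (chartDiff I e p v) (chartDiff I e p w))

/-- The covariant derivative `(∇_u A) v` at `p`, for the Levi-Civita connection of `g`, computed
in the chart `e`. -/
def covDerivEndo (g : BilinField I M) (A : EndoField I M) (e : OpenPartialHomeomorph M H) (p : M)
    (u v : TangentSpace I p) : TangentSpace I p :=
  chartLift I e p (coordCovDerivEndo (g.inChart e) (A.inChart e) (e.extend I p)
    (chartDiff I e p u) (chartDiff I e p v))

/-- The sectional curvature of the plane spanned by `u` and `v`, computed in the chart `e`. -/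
def sectionalCurvature (g : BilinField I M) (e : OpenPartialHomeomorph M H) (p : M)
    (u v : TangentSpace I p) : ℝ :=
  g p (riemannCurvature g e p u v v) u / (g p u u * g p v v - g p u v ^ 2)

/-- The Codazzi equation `(∇_X A) Y = (∇_Y A) X` (in every chart of the atlas). -/
def SatisfiesCodazzi (g : BilinField I M) (A : EndoField I M) : Prop :=
  ∀ e ∈ atlas H M, ∀ p ∈ e.source, ∀ X Y : TangentSpace I p,
    covDerivEndo g A e p X Y = covDerivEndo g A e p Y X

/-- The Gauss equation
`R(X, Y) Z = ⟨A Y, Z⟩ A X - ⟨A X, Z⟩ A Y + κ (⟨Y, Z⟩ X - ⟨X, Z⟩ Y)`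
(in every chart of the atlas). -/
def SatisfiesGauss (g : BilinField I M) (A : EndoField I M) (κ : ℝ) : Prop :=
  ∀ e ∈ atlas H M, ∀ p ∈ e.source, ∀ X Y Z : TangentSpace I p,
    riemannCurvature g e p X Y Z =
      g p (A p Y) Z • A p X - g p (A p X) Z • A p Y + κ • (g p Y Z • X - g p X Z • Y)

/-- On `s`, every nondegenerate tangent plane has sectional curvature `κ`
(in every chart of the atlas). -/
def HasConstantSectionalCurvatureOn (g : BilinField I M) (κ : ℝ) (s : Set M) : Prop :=
  ∀ e ∈ atlas H M, ∀ p ∈ e.source ∩ s, ∀ u v : TangentSpace I p,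
    g p u u * g p v v - g p u v ^ 2 ≠ 0 → sectionalCurvature g e p u v = κ

/-- On `s`, the curvature tensor is `R(X, Y) Z = κ (⟨Y, Z⟩ X - ⟨X, Z⟩ Y)`
(in every chart of the atlas). -/
def HasConstantCurvatureTensorOn (g : BilinField I M) (κ : ℝ) (s : Set M) : Prop :=
  ∀ e ∈ atlas H M, ∀ p ∈ e.source ∩ s, ∀ X Y Z : TangentSpace I p,
    riemannCurvature g e p X Y Z = κ • (g p Y Z • X - g p X Z • Y)

/-! ## The generalized cylinder -/

/-- The metric `g_t(X, Y) = g((cs_κ(t) id - sn_κ(t) A)² X, Y)` on `M`. -/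
def sliceMetric (g : BilinField I M) (A : EndoField I M) (κ t : ℝ) : BilinField I M :=
  fun p =>
    let B : TangentSpace I p →L[ℝ] TangentSpace I p :=
      genCos κ t • ContinuousLinearMap.id ℝ (TangentSpace I p) - genSin κ t • A p
    (g p).comp (B.comp B)

/-- The metric `dt² + h_t` on `ℝ × M`, for a family `h_t` of fields of bilinear forms on `M`. -/
def cylinderMetric (h : ℝ → BilinField I M) : BilinField (𝓘(ℝ, ℝ).prod I) (ℝ × M) :=
  fun x =>
    bilinPullback (ContinuousLinearMap.mul ℝ ℝ) (ContinuousLinearMap.fst ℝ ℝ (TangentSpace I x.2))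
      + bilinPullback (h x.1 x.2) (ContinuousLinearMap.snd ℝ ℝ (TangentSpace I x.2))

end Manifold

end

/-! In a suitable frame, the Levi-Civita connection of `dt² + g_t` and its curvature are explicit.
Write `B = cs_κ(t) id - sn_κ(t) A`, with `t`-derivative `B' = -κ sn_κ(t) id - cs_κ(t) A`. The
map `F = dt ⊕ B` is an isometry from `dt² + g_t` to the metric `dt² + g` on the bundle `ℝ ⊕ TM` over
the cylinder, and on that bundle `∂ + θ`, with
`θ(X)(c, w) = (-g(B' X, w), Γ(X, w) + c B' X)`, is a metric connection. The one-form `F` with values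
in `ℝ ⊕ TM` is closed for this connection: `B` and `B'` commute and are symmetric, and `B` is a
Codazzi tensor. A closed isometric frame transports the connection to the Levi-Civita connection
(`map_coordChristoffel_of_frame`), hence also the curvature (`map_coordCurvature_of_frame`), and the
derivative of `F⁻¹` never has to be computed.

The curvature of `∂ + θ` is algebraic in `A` by the Gauss equation, and `B'' = -κ B` together with
`cs_κ² + κ sn_κ² = 1` turns it into `κ (⟨F Y, W⟩ F X - ⟨F X, W⟩ F Y)`. This is
`coordCurvature_cylinder`.

All this is a computation on an open subset of the model space. The passage to the manifold uses
that the differentials of a chart and of its inverse are mutually inverse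
(`chartDiff_chartSymmDiff`, `chartSymmDiff_chartDiff`), that the charts of `ℝ × M` are the products
of the identity with charts of `M`, and that smoothness of a tensor field can be tested in charts.
The form `dt² + g_t` is nondegenerate exactly where `B` is injective, which is an open condition. -/

-- Instances on threefold iterated spaces of continuous linear maps need the larger depth.
set_option maxSynthPendingDepth 3

/-! ### Invertible continuous linear maps in finite dimension -/

section LinearAlgebra

variable {V W : Type*} [NormedAddCommGroup V] [NormedSpace ℝ V] [FiniteDimensional ℝ V]
  [NormedAddCommGroup W] [NormedSpace ℝ W]

lemma ContinuousLinearMap.isInvertible_of_finrank_eq [FiniteDimensional ℝ W] (L : V →L[ℝ] W)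
    (h : ∀ v, L v = 0 → v = 0) (hd : Module.finrank ℝ V = Module.finrank ℝ W) :
    L.IsInvertible := by
  have hinj : Function.Injective (L : V →ₗ[ℝ] W) :=
    (injective_iff_map_eq_zero _).2 h
  exact ⟨((L : V →ₗ[ℝ] W).linearEquivOfInjective hinj hd).toContinuousLinearEquiv,
    by ext v; rfl⟩

lemma ContinuousLinearMap.isInvertible_of_nondegenerate (b : V →L[ℝ] V →L[ℝ] ℝ)
    (h : ∀ v, (∀ w, b v w = 0) → v = 0) : b.IsInvertible := by
  refine b.isInvertible_of_finrank_eq (fun v hv => h v fun w => by simp [hv]) ?_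
  rw [← (LinearMap.toContinuousLinearMap (𝕜 := ℝ) (E := V) (F' := ℝ)).finrank_eq]
  exact Subspace.dual_finrank_eq.symm

lemma ContinuousLinearMap.IsInvertible.eventually {X : Type*} [TopologicalSpace X]
    {f : X → V →L[ℝ] W} {x : X} (h : (f x).IsInvertible) (hf : ContinuousAt f x) :
    ∀ᶠ y in 𝓝 x, (f y).IsInvertible := by
  have := FiniteDimensional.complete ℝ V
  obtain ⟨e, he⟩ := h
  have h1 : ∀ᶠ L in 𝓝 (f x), L ∈ Set.range ((↑) : (V ≃L[ℝ] W) → V →L[ℝ] W) := by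
    rw [← he]; exact e.nhds
  filter_upwards [hf.eventually h1] with y ⟨e', he'⟩
  exact ⟨e', he'⟩

end LinearAlgebra

/-! ### The Levi-Civita connection in coordinates -/

section Coordinates

variable {E : Type*} [NormedAddCommGroup E] [NormedSpace ℝ E]
  {V : Type*} [NormedAddCommGroup V] [NormedSpace ℝ V]

/-- The fundamental theorem of semi-Riemannian geometry, uniqueness part: a torsion-free metric
connection has the Christoffel symbols of the Koszul formula. -/
lemma coordChristoffel_eq_of_metric_of_torsionFree {G : E → E →L[ℝ] E →L[ℝ] ℝ} {y : E}
    (hinv : (G y).IsInvertible) (hsymm : ∀ u v, G y u v = G y v u) {C : E → E → E}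
    (htor : ∀ u v, C u v = C v u)
    (hmetric : ∀ u v w, fderiv ℝ G y u v w = G y (C u v) w + G y v (C u w)) (u v : E) :
    coordChristoffel G y u v = C u v := by
  rw [coordChristoffel, hinv.inverse_apply_eq]
  ext w
  simp only [coordKoszul, smul_apply, sub_apply,
    add_apply, ContinuousLinearMap.flip_apply, hmetric, smul_eq_mul]
  rw [htor v u, htor w u, htor w v, hsymm v, hsymm u, hsymm (C u w) v]
  ring

/-- The derivatives of a field of symmetric bilinear forms are symmetric. -/
lemma fderiv_apply_apply_comm {G : E → V →L[ℝ] V →L[ℝ] ℝ} {y : E}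
    (hG : DifferentiableAt ℝ G y) (hsymm : ∀ᶠ z in 𝓝 y, ∀ u v, G z u v = G z v u)
    (w : E) (u v : V) : fderiv ℝ G y w u v = fderiv ℝ G y w v u := by
  have key : ∀ a b, fderiv ℝ (fun z => G z a b) y w = fderiv ℝ G y w a b := fun a b => by
    have := (hG.hasFDerivAt.clm_apply (hasFDerivAt_const a y)).clm_apply (hasFDerivAt_const b y)
    rw [this.fderiv]; simp
  rw [← key, ← key]
  have h : (fun z => G z u v) =ᶠ[𝓝 y] fun z => G z v u := hsymm.mono fun z hz => hz u v
  rw [h.fderiv_eq]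

/-- The Christoffel symbols of `G` at `y`, as a continuous bilinear map. -/
noncomputable def christoffelCLM (G : E → E →L[ℝ] E →L[ℝ] ℝ) (y : E) : E →L[ℝ] E →L[ℝ] E :=
  (ContinuousLinearMap.compL ℝ E (E →L[ℝ] ℝ) E (G y).inverse).comp
    ((1 / 2 : ℝ) • (fderiv ℝ G y + (fderiv ℝ G y).flip
      - ((ContinuousLinearMap.flipₗᵢ ℝ E E ℝ).toContinuousLinearEquiv.toContinuousLinearMap.comp (fderiv ℝ G y).flip)))

lemma christoffelCLM_apply (G : E → E →L[ℝ] E →L[ℝ] ℝ) (y u v : E) :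
    christoffelCLM G y u v = coordChristoffel G y u v := by
  simp only [christoffelCLM, coordChristoffel, coordKoszul, ContinuousLinearMap.comp_apply,
    ContinuousLinearMap.compL_apply]
  rfl

lemma coordChristoffel_comm {G : E → E →L[ℝ] E →L[ℝ] ℝ} {y : E}
    (hG : DifferentiableAt ℝ G y) (hsymm : ∀ᶠ z in 𝓝 y, ∀ u v, G z u v = G z v u) (u v : E) :
    coordChristoffel G y u v = coordChristoffel G y v u := by
  have : coordKoszul G y u v = coordKoszul G y v u := by
    ext w
    simp only [coordKoszul, smul_apply, sub_apply,
      add_apply, ContinuousLinearMap.flip_apply,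
      fderiv_apply_apply_comm hG hsymm w u v]
    ring_nf
  rw [coordChristoffel, this, coordChristoffel]

/-- The Levi-Civita connection is metric: `∂_u G(v, w) = G(∇_u v, w) + G(v, ∇_u w)`. -/
lemma fderiv_eq_coordChristoffel {G : E → E →L[ℝ] E →L[ℝ] ℝ} {y : E}
    (hG : DifferentiableAt ℝ G y) (hinv : (G y).IsInvertible)
    (hsymm : ∀ᶠ z in 𝓝 y, ∀ u v, G z u v = G z v u) (u v w : E) :
    fderiv ℝ G y u v w
      = G y (coordChristoffel G y u v) w + G y v (coordChristoffel G y u w) := by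
  have h : ∀ a b, G y (coordChristoffel G y a b) = coordKoszul G y a b := fun a b =>
    hinv.self_apply_inverse _
  rw [hsymm.self_of_nhds v, h, h]
  simp only [coordKoszul, smul_apply, sub_apply,
    add_apply, ContinuousLinearMap.flip_apply, smul_eq_mul]
  have c := fun a b c => fderiv_apply_apply_comm hG hsymm a b c
  rw [c u w v]
  ring

lemma differentiableAt_christoffelCLM [CompleteSpace E] {G : E → E →L[ℝ] E →L[ℝ] ℝ} {y : E}
    (hG : ContDiffAt ℝ 2 G y) (hinv : (G y).IsInvertible) :
    DifferentiableAt ℝ (christoffelCLM G) y := by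
  have hG' : DifferentiableAt ℝ (fderiv ℝ G) y :=
    (hG.fderiv_right (m := 1) (by norm_num)).differentiableAt one_ne_zero
  have hi : DifferentiableAt ℝ (fun z => (G z).inverse) y :=
    ((hinv.contDiffAt_map_inverse (n := 1)).comp y
      (hG.of_le (by norm_num))).differentiableAt one_ne_zero
  have hflip : DifferentiableAt ℝ (fun z => (fderiv ℝ G z).flip) y :=
    (ContinuousLinearMap.flipₗᵢ ℝ E E (E →L[ℝ] ℝ)).toContinuousLinearEquiv.differentiableAt.comp
      y hG'
  have h3 : DifferentiableAt ℝ (fun z =>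
      ((ContinuousLinearMap.flipₗᵢ ℝ E E ℝ).toContinuousLinearEquiv.toContinuousLinearMap.comp (fderiv ℝ G z).flip)) y :=
    (differentiableAt_const _).clm_comp hflip
  unfold christoffelCLM
  refine DifferentiableAt.clm_comp ?_ (((hG'.add hflip).sub h3).const_smul (1 / 2 : ℝ))
  exact (ContinuousLinearMap.compL ℝ E (E →L[ℝ] ℝ) E).differentiableAt.comp y hi

/-! ### Levi-Civita connection and curvature in a moving frame -/

section Frame

variable {Gh : E → E →L[ℝ] E →L[ℝ] ℝ} {q : E → V →L[ℝ] V →L[ℝ] ℝ} {F : E → E →L[ℝ] V}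
  {θ : E → E →L[ℝ] V →L[ℝ] V} {z : E}

/-- `F` is a fibrewise isometry onto a trivial bundle with fibre metric `q` and metric
connection `d + θ`, and `F`, as a one-form with values in that bundle, is closed; then `F`
intertwines the Levi-Civita connection of `q(F ·, F ·)` with `d + θ`. -/
lemma map_coordChristoffel_of_frame
    (hGh : ∀ᶠ y in 𝓝 z, ∀ X Y, Gh y X Y = q y (F y X) (F y Y))
    (hF : DifferentiableAt ℝ F z) (hq : DifferentiableAt ℝ q z)
    (hFinv : (F z).IsInvertible) (hGinv : (Gh z).IsInvertible)
    (hsymm : ∀ a b, q z a b = q z b a)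
    (hmetric : ∀ X a b, fderiv ℝ q z X a b = q z (θ z X a) b + q z a (θ z X b))
    (htor : ∀ X Y, fderiv ℝ F z X Y + θ z X (F z Y) = fderiv ℝ F z Y X + θ z Y (F z X))
    (X Y : E) :
    F z (coordChristoffel Gh z X Y) = fderiv ℝ F z X Y + θ z X (F z Y) := by
  have hC : ∀ X Y, F z ((F z).inverse (fderiv ℝ F z X Y + θ z X (F z Y)))
      = fderiv ℝ F z X Y + θ z X (F z Y) := fun X Y => hFinv.self_apply_inverse _
  rw [coordChristoffel_eq_of_metric_of_torsionFree hGinv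
    (C := fun X Y => (F z).inverse (fderiv ℝ F z X Y + θ z X (F z Y))), hC]
  · intro u v
    rw [hGh.self_of_nhds, hGh.self_of_nhds, hsymm]
  · intro u v
    simp only [htor u v]
  · intro u v w
    have h0 := (ContinuousLinearMap.hasFDerivAt
      (ContinuousLinearMap.compL ℝ E V ℝ).flip (x := F z)).comp z hF.hasFDerivAt
    have h1 := h0.clm_comp (hq.hasFDerivAt.clm_comp hF.hasFDerivAt)
    have hGd := h1.congr_of_eventuallyEq (f₁ := Gh) (hGh.mono fun y hy => by
      ext a b
      exact hy a b)
    rw [hGh.self_of_nhds, hGh.self_of_nhds, hGd.fderiv]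
    simp only [hC]
    simp only [Function.comp_apply, add_apply,
      ContinuousLinearMap.comp_apply, ContinuousLinearMap.compL_apply,
      ContinuousLinearMap.flip_apply, hmetric, map_add]
    ring

/-- The frame `F` also intertwines the curvatures: the right-hand side is the curvature of the
connection `d + θ`. -/
lemma map_coordCurvature_of_frame [CompleteSpace E]
    (hGh : ∀ᶠ y in 𝓝 z, ∀ X Y, Gh y X Y = q y (F y X) (F y Y))
    (hF : ContDiffAt ℝ 2 F z) (hq : ∀ᶠ y in 𝓝 z, DifferentiableAt ℝ q y)
    (hθ : DifferentiableAt ℝ θ z)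
    (hFinv : ∀ᶠ y in 𝓝 z, (F y).IsInvertible) (hGinv : ∀ᶠ y in 𝓝 z, (Gh y).IsInvertible)
    (hsymm : ∀ᶠ y in 𝓝 z, ∀ a b, q y a b = q y b a)
    (hmetric : ∀ᶠ y in 𝓝 z, ∀ X a b,
      fderiv ℝ q y X a b = q y (θ y X a) b + q y a (θ y X b))
    (htor : ∀ᶠ y in 𝓝 z, ∀ X Y,
      fderiv ℝ F y X Y + θ y X (F y Y) = fderiv ℝ F y Y X + θ y Y (F y X))
    (u v w : E) :
    F z (coordCurvature Gh z u v w) = fderiv ℝ θ z u v (F z w) - fderiv ℝ θ z v u (F z w)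
      + θ z u (θ z v (F z w)) - θ z v (θ z u (F z w)) := by
  have hFd : ∀ᶠ y in 𝓝 z, DifferentiableAt ℝ F y :=
    (hF.eventually (by simp)).mono fun y hy => hy.differentiableAt (by norm_num)
  have hΓ : ∀ᶠ y in 𝓝 z, ∀ X Y,
      F y (coordChristoffel Gh y X Y) = fderiv ℝ F y X Y + θ y X (F y Y) := by
    filter_upwards [hGh.eventually_nhds, hFd, hq, hFinv, hGinv, hsymm, hmetric, htor]
      with y h1 h2 h3 h4 h5 h6 h7 h8
    exact map_coordChristoffel_of_frame h1 h2 h3 h4 h5 h6 h7 h8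
  have hF' : HasFDerivAt F (fderiv ℝ F z) z := hFd.self_of_nhds.hasFDerivAt
  have hF'' : HasFDerivAt (fderiv ℝ F) (fderiv ℝ (fderiv ℝ F) z) z :=
    ((hF.fderiv_right (m := 1) (by norm_num)).differentiableAt one_ne_zero).hasFDerivAt
  have hi : DifferentiableAt ℝ (fun y => (F y).inverse) z :=
    ((hFinv.self_of_nhds.contDiffAt_map_inverse (n := 1)).comp z
      (hF.of_le (by norm_num))).differentiableAt one_ne_zero
  have hS : ∀ v, HasFDerivAt (fun y => fderiv ℝ F y v w + θ y v (F y w)) _ z := fun v =>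
    ((hF''.clm_apply (hasFDerivAt_const v z)).clm_apply (hasFDerivAt_const w z)).add
      ((hθ.hasFDerivAt.clm_apply (hasFDerivAt_const v z)).clm_apply
        (hF'.clm_apply (hasFDerivAt_const w z)))
  have hP : ∀ v, DifferentiableAt ℝ (fun y => coordChristoffel Gh y v w) z := fun v => by
    refine (hi.clm_apply (hS v).differentiableAt).congr_of_eventuallyEq ?_
    filter_upwards [hΓ, hFinv] with y hy hy'
    simp only [← hy]
    exact (hy'.inverse_apply_self _).symm
  -- differentiating `F (Γ(v, w)) = ∂_v F w + θ(v) (F w)`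
  have key : ∀ u v, F z (fderiv ℝ (fun y => coordChristoffel Gh y v w) z u)
      + fderiv ℝ F z u (coordChristoffel Gh z v w)
      = fderiv ℝ (fderiv ℝ F) z u v w + fderiv ℝ θ z u v (F z w)
        + θ z v (fderiv ℝ F z u w) := fun u v => by
    have h1 : HasFDerivAt (fun y => F y (coordChristoffel Gh y v w)) _ z :=
      hF'.clm_apply (hP v).hasFDerivAt
    have h2 : (fun y => F y (coordChristoffel Gh y v w))
        =ᶠ[𝓝 z] fun y => fderiv ℝ F y v w + θ y v (F y w) := hΓ.mono fun y hy => hy v w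
    have h3 := congrArg (fun L => L u) (h1.unique ((hS v).congr_of_eventuallyEq h2))
    simp at h3
    rw [h3]; abel
  have hsnd : fderiv ℝ (fderiv ℝ F) z u v = fderiv ℝ (fderiv ℝ F) z v u :=
    (hF.isSymmSndFDerivAt (by simp)) u v
  have e1 := key u v
  have e2 := key v u
  have hΓ := hΓ.self_of_nhds
  rw [coordCurvature, map_sub, map_add, map_sub, hΓ u, hΓ v (coordChristoffel Gh z u w),
    hΓ, hΓ, eq_sub_of_add_eq e1, eq_sub_of_add_eq e2, hsnd]
  simp only [map_add]
  abel

end Frame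

end Coordinates

/-! ### Generalized sine and cosine -/

section GeneralizedTrigonometry

lemma genCos_sq_add (κ t : ℝ) : genCos κ t ^ 2 + κ * genSin κ t ^ 2 = 1 := by
  unfold genCos genSin
  split_ifs with h h'
  · have : √κ ^ 2 = κ := Real.sq_sqrt h.le
    have h0 : √κ ≠ 0 := (Real.sqrt_pos.2 h).ne'
    rw [div_pow, this, mul_div_cancel₀ _ h.ne']
    exact Real.cos_sq_add_sin_sq _
  · simp [h']
  · have hn : κ < 0 := lt_of_le_of_ne (not_lt.1 h) h'
    have : √|κ| ^ 2 = -κ := by rw [Real.sq_sqrt (abs_nonneg _), abs_of_neg hn]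
    rw [div_pow, this, div_neg, mul_neg, mul_div_cancel₀ _ h', Real.cosh_sq]
    ring

lemma hasDerivAt_genSin (κ t : ℝ) : HasDerivAt (genSin κ) (genCos κ t) t := by
  unfold genCos
  split_ifs with h h'
  · have h0 : √κ ≠ 0 := (Real.sqrt_pos.2 h).ne'
    have : genSin κ = fun t => Real.sin (√κ * t) / √κ := by ext; simp [genSin, h]
    rw [this]
    have h1 := (((hasDerivAt_id t).const_mul √κ).sin).div_const √κ
    refine HasDerivAt.congr_deriv h1 ?_
    simp only [id, mul_one]
    field_simp
  · have : genSin κ = fun t => t := by ext; simp [genSin, h']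
    rw [this]; exact hasDerivAt_id t
  · have h0 : √|κ| ≠ 0 := (Real.sqrt_pos.2 (abs_pos.2 h')).ne'
    have : genSin κ = fun t => Real.sinh (√|κ| * t) / √|κ| := by ext; simp [genSin, h, h']
    rw [this]
    have h1 := (((hasDerivAt_id t).const_mul √|κ|).sinh).div_const √|κ|
    refine HasDerivAt.congr_deriv h1 ?_
    simp only [id, mul_one]
    field_simp

lemma hasDerivAt_genCos (κ t : ℝ) : HasDerivAt (genCos κ) (-(κ * genSin κ t)) t := by
  unfold genSin
  split_ifs with h h'
  · have h0 : √κ ≠ 0 := (Real.sqrt_pos.2 h).ne'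
    have hs : √κ ^ 2 = κ := Real.sq_sqrt h.le
    have : genCos κ = fun t => Real.cos (√κ * t) := by ext; simp [genCos, h]
    rw [this]
    have h1 := ((hasDerivAt_id t).const_mul √κ).cos
    refine HasDerivAt.congr_deriv h1 ?_
    simp only [id, mul_one]
    field_simp
    rw [hs]
    ring
  · have : genCos κ = fun t => 1 := by ext; simp [genCos, h']
    rw [this]; simpa [h'] using hasDerivAt_const t (1 : ℝ)
  · have h0 : √|κ| ≠ 0 := (Real.sqrt_pos.2 (abs_pos.2 h')).ne'
    have hn : κ < 0 := lt_of_le_of_ne (not_lt.1 h) h'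
    have hs : √|κ| ^ 2 = -κ := by rw [Real.sq_sqrt (abs_nonneg _), abs_of_neg hn]
    have : genCos κ = fun t => Real.cosh (√|κ| * t) := by ext; simp [genCos, h, h']
    rw [this]
    have h1 := ((hasDerivAt_id t).const_mul √|κ|).cosh
    refine HasDerivAt.congr_deriv h1 ?_
    simp only [id, mul_one]
    field_simp
    rw [hs]
    ring

lemma contDiff_genSin (κ : ℝ) : ContDiff ℝ ∞ (genSin κ) := by
  by_cases h : 0 < κ
  · have : genSin κ = fun t => Real.sin (√κ * t) / √κ := by ext; simp [genSin, h]
    rw [this]; fun_prop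
  · by_cases h' : κ = 0
    · have : genSin κ = fun t => t := by ext; simp [genSin, h']
      rw [this]; fun_prop
    · have : genSin κ = fun t => Real.sinh (√|κ| * t) / √|κ| := by ext; simp [genSin, h, h']
      rw [this]; fun_prop

lemma contDiff_genCos (κ : ℝ) : ContDiff ℝ ∞ (genCos κ) := by
  have : genCos κ = deriv (genSin κ) := by ext t; exact (hasDerivAt_genSin κ t).deriv.symm
  rw [this]
  exact ((contDiff_infty_iff_deriv).1 (contDiff_genSin κ)).2

lemma genSin_zero (κ : ℝ) : genSin κ 0 = 0 := by simp [genSin]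

lemma genCos_zero (κ : ℝ) : genCos κ 0 = 1 := by simp [genCos]

end GeneralizedTrigonometry

/-! ### The frame and the connection form of the cylinder -/

section Cylinder

variable {E : Type*} [NormedAddCommGroup E] [NormedSpace ℝ E]

/-- The endomorphism `cs_κ(t) id - sn_κ(t) A` at the point `z = (t, y)` of the cylinder. -/
noncomputable def cylEndo (κ : ℝ) (A : E → E →L[ℝ] E) (z : ℝ × E) : E →L[ℝ] E :=
  genCos κ z.1 • ContinuousLinearMap.id ℝ E - genSin κ z.1 • A z.2

/-- The derivative of `cylEndo` in the direction of `t`. -/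
noncomputable def cylEndoDeriv (κ : ℝ) (A : E → E →L[ℝ] E) (z : ℝ × E) : E →L[ℝ] E :=
  (-(κ * genSin κ z.1)) • ContinuousLinearMap.id ℝ E - genCos κ z.1 • A z.2

lemma cylEndo_apply (κ : ℝ) (A : E → E →L[ℝ] E) (z : ℝ × E) (v : E) :
    cylEndo κ A z v = genCos κ z.1 • v - genSin κ z.1 • A z.2 v := rfl

lemma cylEndoDeriv_apply (κ : ℝ) (A : E → E →L[ℝ] E) (z : ℝ × E) (v : E) :
    cylEndoDeriv κ A z v = (-(κ * genSin κ z.1)) • v - genCos κ z.1 • A z.2 v := rfl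

/-- The frame `dt ⊕ (cs_κ(t) id - sn_κ(t) A)`, a fibrewise isometry from the cylinder metric to
the metric `dt² + g`. -/
noncomputable def cylFrame (κ : ℝ) (A : E → E →L[ℝ] E) (z : ℝ × E) : ℝ × E →L[ℝ] ℝ × E :=
  (ContinuousLinearMap.inl ℝ ℝ E).comp (ContinuousLinearMap.fst ℝ ℝ E)
    + (ContinuousLinearMap.inr ℝ ℝ E).comp
      ((cylEndo κ A z).comp (ContinuousLinearMap.snd ℝ ℝ E))

lemma cylFrame_apply (κ : ℝ) (A : E → E →L[ℝ] E) (z X : ℝ × E) :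
    cylFrame κ A z X = (X.1, cylEndo κ A z X.2) := by
  simp [cylFrame]

/-- The fibre metric `dt² + g` at the point `z = (t, y)`. -/
noncomputable def cylFiberMetric (G : E → E →L[ℝ] E →L[ℝ] ℝ) (z : ℝ × E) :
    ℝ × E →L[ℝ] ℝ × E →L[ℝ] ℝ :=
  bilinPullback (ContinuousLinearMap.mul ℝ ℝ) (ContinuousLinearMap.fst ℝ ℝ E)
    + ((ContinuousLinearMap.compL ℝ (ℝ × E) E ℝ).flip (ContinuousLinearMap.snd ℝ ℝ E)).comp
      ((G z.2).comp (ContinuousLinearMap.snd ℝ ℝ E))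

lemma cylFiberMetric_apply (G : E → E →L[ℝ] E →L[ℝ] ℝ) (z X Y : ℝ × E) :
    cylFiberMetric G z X Y = X.1 * Y.1 + G z.2 X.2 Y.2 := by
  simp [cylFiberMetric, bilinPullback]

/-- The connection form `θ(X)(c, w) = (-g(B' X, w), Γ(X, w) + c B' X)`, where `B'` is
`cylEndoDeriv`: transported by `cylFrame`, it is the Levi-Civita connection of the cylinder. -/
noncomputable def cylConnection (κ : ℝ) (G : E → E →L[ℝ] E →L[ℝ] ℝ) (A : E → E →L[ℝ] E)
    (z : ℝ × E) : ℝ × E →L[ℝ] ℝ × E →L[ℝ] ℝ × E :=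
  (ContinuousLinearMap.compL ℝ (ℝ × E) E (ℝ × E)).flip (ContinuousLinearMap.snd ℝ ℝ E) ∘L
      ((ContinuousLinearMap.compL ℝ E E (ℝ × E) (ContinuousLinearMap.inr ℝ ℝ E) ∘L
          christoffelCLM G z.2
        - ContinuousLinearMap.compL ℝ E ℝ (ℝ × E) (ContinuousLinearMap.inl ℝ ℝ E) ∘L
          (G z.2 ∘L cylEndoDeriv κ A z)) ∘L ContinuousLinearMap.snd ℝ ℝ E)
    + (ContinuousLinearMap.smulRightL ℝ (ℝ × E) (ℝ × E) (ContinuousLinearMap.fst ℝ ℝ E) ∘L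
      ContinuousLinearMap.inr ℝ ℝ E) ∘L (cylEndoDeriv κ A z ∘L ContinuousLinearMap.snd ℝ ℝ E)

lemma cylConnection_apply (κ : ℝ) (G : E → E →L[ℝ] E →L[ℝ] ℝ) (A : E → E →L[ℝ] E)
    (z X W : ℝ × E) :
    cylConnection κ G A z X W = (-G z.2 (cylEndoDeriv κ A z X.2) W.2,
      christoffelCLM G z.2 X.2 W.2 + W.1 • cylEndoDeriv κ A z X.2) := by
  simp [cylConnection]

lemma contDiffAt_cylEndo (κ : ℝ) {A : E → E →L[ℝ] E} {z : ℝ × E} {n : ℕ∞}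
    (hA : ContDiffAt ℝ n A z.2) : ContDiffAt ℝ n (cylEndo κ A) z := by
  have hs : ContDiffAt ℝ n (fun z : ℝ × E => genSin κ z.1) z :=
    (((contDiff_genSin κ).of_le (by exact_mod_cast le_top)).comp contDiff_fst).contDiffAt
  have hc : ContDiffAt ℝ n (fun z : ℝ × E => genCos κ z.1) z :=
    (((contDiff_genCos κ).of_le (by exact_mod_cast le_top)).comp contDiff_fst).contDiffAt
  exact (hc.smul contDiffAt_const).sub (hs.smul (hA.comp z contDiffAt_snd))

lemma contDiffAt_cylFrame (κ : ℝ) {A : E → E →L[ℝ] E} {z : ℝ × E} {n : ℕ∞}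
    (hA : ContDiffAt ℝ n A z.2) : ContDiffAt ℝ n (cylFrame κ A) z :=
  contDiffAt_const.add (contDiffAt_const.clm_comp
    ((contDiffAt_cylEndo κ hA).clm_comp contDiffAt_const))

lemma hasFDerivAt_comp_fst {f : ℝ → ℝ} {f' : ℝ} {z : ℝ × E} (h : HasDerivAt f f' z.1) :
    HasFDerivAt (fun z : ℝ × E => f z.1) (f' • ContinuousLinearMap.fst ℝ ℝ E) z :=
  h.comp_hasFDerivAt z hasFDerivAt_fst

lemma hasFDerivAt_comp_snd {W : Type*} [NormedAddCommGroup W] [NormedSpace ℝ W] {f : E → W}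
    {z : ℝ × E} (h : DifferentiableAt ℝ f z.2) :
    HasFDerivAt (fun z : ℝ × E => f z.2)
      ((fderiv ℝ f z.2).comp (ContinuousLinearMap.snd ℝ ℝ E)) z :=
  h.hasFDerivAt.comp z hasFDerivAt_snd

lemma exists_hasFDerivAt_cylEndo (κ : ℝ) {A : E → E →L[ℝ] E} {z : ℝ × E}
    (hA : DifferentiableAt ℝ A z.2) :
    ∃ L : ℝ × E →L[ℝ] E →L[ℝ] E, HasFDerivAt (cylEndo κ A) L z ∧ ∀ X v, L X v
      = X.1 • cylEndoDeriv κ A z v - genSin κ z.1 • fderiv ℝ A z.2 X.2 v := by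
  have h := ((hasFDerivAt_comp_fst (E := E) (hasDerivAt_genCos κ z.1)).smul
    (hasFDerivAt_const (ContinuousLinearMap.id ℝ E) z)).sub
    ((hasFDerivAt_comp_fst (E := E) (hasDerivAt_genSin κ z.1)).smul (hasFDerivAt_comp_snd hA))
  refine ⟨_, h, fun X v => ?_⟩
  simp [cylEndoDeriv_apply]
  module

lemma exists_hasFDerivAt_cylEndoDeriv (κ : ℝ) {A : E → E →L[ℝ] E} {z : ℝ × E}
    (hA : DifferentiableAt ℝ A z.2) :
    ∃ L : ℝ × E →L[ℝ] E →L[ℝ] E, HasFDerivAt (cylEndoDeriv κ A) L z ∧ ∀ X v, L X v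
      = -(κ * X.1) • cylEndo κ A z v - genCos κ z.1 • fderiv ℝ A z.2 X.2 v := by
  have h := ((hasFDerivAt_comp_fst (E := E) ((hasDerivAt_genSin κ z.1).const_mul κ).neg).smul
    (hasFDerivAt_const (ContinuousLinearMap.id ℝ E) z)).sub
    ((hasFDerivAt_comp_fst (E := E) (hasDerivAt_genCos κ z.1)).smul (hasFDerivAt_comp_snd hA))
  refine ⟨_, h, fun X v => ?_⟩
  simp [cylEndo_apply]
  module

end Cylinder

/-! ### The curvature of the cylinder in coordinates -/

section Cylinder

variable {E : Type*} [NormedAddCommGroup E] [NormedSpace ℝ E]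
  {κ : ℝ} {G : E → E →L[ℝ] E →L[ℝ] ℝ} {A : E → E →L[ℝ] E}

/-- The connection form `cylConnection` preserves the fibre metric `dt² + g`. -/
lemma fderiv_cylFiberMetric {z : ℝ × E} (hG : DifferentiableAt ℝ G z.2)
    (hinv : (G z.2).IsInvertible) (hsymm : ∀ᶠ y in 𝓝 z.2, ∀ u v, G y u v = G y v u)
    (X a b : ℝ × E) :
    DifferentiableAt ℝ (cylFiberMetric G) z ∧ fderiv ℝ (cylFiberMetric G) z X a b
      = cylFiberMetric G z (cylConnection κ G A z X a) b
        + cylFiberMetric G z a (cylConnection κ G A z X b) := by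
  have h1 := (hasFDerivAt_const (bilinPullback (ContinuousLinearMap.mul ℝ ℝ)
    (ContinuousLinearMap.fst ℝ ℝ E)) z).add
    ((hasFDerivAt_const ((ContinuousLinearMap.compL ℝ (ℝ × E) E ℝ).flip
      (ContinuousLinearMap.snd ℝ ℝ E)) z).clm_comp
    ((hasFDerivAt_comp_snd hG).clm_comp (hasFDerivAt_const (ContinuousLinearMap.snd ℝ ℝ E) z)))
  have h2 : HasFDerivAt (cylFiberMetric G) _ z := h1
  refine ⟨h2.differentiableAt, ?_⟩
  rw [h2.fderiv]
  simp [cylFiberMetric_apply, cylConnection_apply, fderiv_eq_coordChristoffel hG hinv hsymm,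
    christoffelCLM_apply, hsymm.self_of_nhds a.2]
  ring

/-- `B` and `B'` are symmetric and commute, both being polynomials in `A`. -/
lemma cylEndo_comm_symm {z : ℝ × E} (hA : ∀ v w, G z.2 (A z.2 v) w = G z.2 v (A z.2 w))
    (v w : E) : G z.2 (cylEndoDeriv κ A z v) (cylEndo κ A z w)
      = G z.2 (cylEndo κ A z v) (cylEndoDeriv κ A z w) := by
  simp only [cylEndo_apply, cylEndoDeriv_apply, map_sub, map_smul, sub_apply, smul_apply,
    smul_eq_mul, hA]
  ring

/-- By the Codazzi equation, the frame is closed with respect to the connection form. -/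
lemma fderiv_cylFrame_add_cylConnection_comm {z : ℝ × E} (hAd : DifferentiableAt ℝ A z.2)
    (hG : DifferentiableAt ℝ G z.2) (hsymm : ∀ᶠ y in 𝓝 z.2, ∀ u v, G y u v = G y v u)
    (hA : ∀ v w, G z.2 (A z.2 v) w = G z.2 v (A z.2 w))
    (hCod : ∀ u v, coordCovDerivEndo G A z.2 u v = coordCovDerivEndo G A z.2 v u)
    (X Y : ℝ × E) :
    fderiv ℝ (cylFrame κ A) z X Y + cylConnection κ G A z X (cylFrame κ A z Y)
      = fderiv ℝ (cylFrame κ A) z Y X + cylConnection κ G A z Y (cylFrame κ A z X) := by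
  obtain ⟨L, hL, hL'⟩ := exists_hasFDerivAt_cylEndo κ hAd
  have h1 := (hasFDerivAt_const ((ContinuousLinearMap.inl ℝ ℝ E).comp
    (ContinuousLinearMap.fst ℝ ℝ E)) z).add
    ((hasFDerivAt_const (ContinuousLinearMap.inr ℝ ℝ E) z).clm_comp
      (hL.clm_comp (hasFDerivAt_const (ContinuousLinearMap.snd ℝ ℝ E) z)))
  have h2 : HasFDerivAt (cylFrame κ A) _ z := h1
  have hF : ∀ X Y, fderiv ℝ (cylFrame κ A) z X Y = (0, L X Y.2) := fun X Y => by
    rw [h2.fderiv]; simp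
  have hc := hCod X.2 Y.2
  simp only [coordCovDerivEndo, coordChristoffel_comm hG hsymm Y.2 X.2, sub_left_inj] at hc
  rw [hF, hF, cylConnection_apply, cylConnection_apply, cylFrame_apply, cylFrame_apply]
  ext
  · simp [cylEndo_comm_symm hA, hsymm.self_of_nhds (cylEndo κ A z X.2)]
  · simp only [Prod.mk_add_mk, hL', cylEndo_apply, map_sub, map_smul, christoffelCLM_apply,
      coordChristoffel_comm hG hsymm Y.2 X.2]
    linear_combination (norm := module) (-genSin κ z.1) • hc

lemma fderiv_christoffelCLM {y : E} (h : DifferentiableAt ℝ (christoffelCLM G) y) (u v w : E) :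
    fderiv ℝ (fun z => coordChristoffel G z v w) y u = fderiv ℝ (christoffelCLM G) y u v w := by
  have h1 := (h.hasFDerivAt.clm_apply (hasFDerivAt_const v y)).clm_apply (hasFDerivAt_const w y)
  simp only [← christoffelCLM_apply]
  rw [h1.fderiv]; simp

/-- The differential of the connection form of the cylinder. -/
lemma fderiv_cylConnection [CompleteSpace E] {z : ℝ × E} (hAd : ContDiffAt ℝ 2 A z.2)
    (hGd : ContDiffAt ℝ 2 G z.2) (hinv : (G z.2).IsInvertible) (X Y W : ℝ × E) :
    DifferentiableAt ℝ (cylConnection κ G A) z ∧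
    fderiv ℝ (cylConnection κ G A) z X Y W =
      (-(fderiv ℝ G z.2 X.2 (cylEndoDeriv κ A z Y.2) W.2
        + G z.2 (-(κ * X.1) • cylEndo κ A z Y.2 - genCos κ z.1 • fderiv ℝ A z.2 X.2 Y.2) W.2),
      fderiv ℝ (christoffelCLM G) z.2 X.2 Y.2 W.2
        + W.1 • (-(κ * X.1) • cylEndo κ A z Y.2 - genCos κ z.1 • fderiv ℝ A z.2 X.2 Y.2)) := by
  obtain ⟨L, hL, hL'⟩ := exists_hasFDerivAt_cylEndoDeriv κ (hAd.differentiableAt two_ne_zero)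
  have hΓ := hasFDerivAt_comp_snd (differentiableAt_christoffelCLM hGd hinv)
  have hG := hasFDerivAt_comp_snd (hGd.differentiableAt two_ne_zero)
  have hd : DifferentiableAt ℝ (cylConnection κ G A) z := by
    unfold cylConnection
    refine DifferentiableAt.add ?_ ?_
    · refine (differentiableAt_const _).clm_comp (DifferentiableAt.clm_comp ?_
        (differentiableAt_const _))
      exact ((differentiableAt_const _).clm_comp hΓ.differentiableAt).sub
        ((differentiableAt_const _).clm_comp (hG.differentiableAt.clm_comp hL.differentiableAt))
    · exact (differentiableAt_const _).clm_comp
        (hL.differentiableAt.clm_comp (differentiableAt_const _))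
  refine ⟨hd, ?_⟩
  have h1 := ((hd.hasFDerivAt.clm_apply (hasFDerivAt_const Y z)).clm_apply
    (hasFDerivAt_const W z))
  have hY := hL.clm_apply (hasFDerivAt_const Y.2 z)
  have h2 := ((hG.clm_apply hY).clm_apply (hasFDerivAt_const W.2 z)).neg.prodMk
    (((hΓ.clm_apply (hasFDerivAt_const Y.2 z)).clm_apply (hasFDerivAt_const W.2 z)).add
      (hY.const_smul W.1))
  simp only [cylConnection_apply] at h1
  have h3 := congrArg (fun L => L X) (h1.unique h2)
  rw [← hL']
  simp at h3
  rw [h3]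
  ext <;> simp
  ring

/-- The cylinder metric over an open subset of a vector space has constant curvature `κ`. -/
theorem coordCurvature_cylinder [FiniteDimensional ℝ E] {U : Set E} (hU : IsOpen U)
    (hG : ContDiffOn ℝ 2 G U) (hA : ContDiffOn ℝ 2 A U)
    (hsymm : ∀ y ∈ U, ∀ u v, G y u v = G y v u)
    (hnd : ∀ y ∈ U, ∀ v, (∀ w, G y v w = 0) → v = 0)
    (hAsymm : ∀ y ∈ U, ∀ v w, G y (A y v) w = G y v (A y w))
    (hCod : ∀ y ∈ U, ∀ u v, coordCovDerivEndo G A y u v = coordCovDerivEndo G A y v u)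
    (hGauss : ∀ y ∈ U, ∀ u v w, coordCurvature G y u v w
      = G y (A y v) w • A y u - G y (A y u) w • A y v + κ • (G y v w • u - G y u w • v))
    {Gh : ℝ × E → ℝ × E →L[ℝ] ℝ × E →L[ℝ] ℝ}
    (hGh : ∀ z : ℝ × E, z.2 ∈ U → ∀ X Y, Gh z X Y
      = X.1 * Y.1 + G z.2 (cylEndo κ A z X.2) (cylEndo κ A z Y.2))
    {z : ℝ × E} (hz : z.2 ∈ U) (hB : ∀ v, cylEndo κ A z v = 0 → v = 0) (u v w : ℝ × E) :
    coordCurvature Gh z u v w = κ • (Gh z v w • u - Gh z u w • v) := by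
  have := FiniteDimensional.complete ℝ E
  have hUz : ∀ᶠ y : ℝ × E in 𝓝 z, y.2 ∈ U :=
    continuous_snd.continuousAt.eventually (hU.mem_nhds hz)
  have hGat : ∀ y ∈ U, ContDiffAt ℝ 2 G y := fun y hy => hG.contDiffAt (hU.mem_nhds hy)
  have hAat : ∀ y ∈ U, ContDiffAt ℝ 2 A y := fun y hy => hA.contDiffAt (hU.mem_nhds hy)
  have hsy : ∀ y ∈ U, ∀ᶠ y' in 𝓝 y, ∀ u v, G y' u v = G y' v u := fun y hy =>
    Filter.mem_of_superset (hU.mem_nhds hy) hsymm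
  have hGi : ∀ y ∈ U, (G y).IsInvertible := fun y hy =>
    (G y).isInvertible_of_nondegenerate (hnd y hy)
  have hFc : ContDiffAt ℝ 2 (cylFrame κ A) z := contDiffAt_cylFrame κ (n := 2) (hAat _ hz)
  have hFi : (cylFrame κ A z).IsInvertible := by
    refine (cylFrame κ A z).isInvertible_of_finrank_eq (fun X hX => ?_) rfl
    rw [cylFrame_apply, Prod.mk_eq_zero] at hX
    exact Prod.ext hX.1 (hB _ hX.2)
  have hFiev := hFi.eventually hFc.continuousAt
  have hq : ∀ y : ℝ × E, y.2 ∈ U → ∀ X Y, Gh y X Y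
      = cylFiberMetric G y (cylFrame κ A y X) (cylFrame κ A y Y) := fun y hy X Y => by
    rw [hGh y hy, cylFiberMetric_apply, cylFrame_apply, cylFrame_apply]
  have hGhi : ∀ᶠ y in 𝓝 z, (Gh y).IsInvertible := by
    filter_upwards [hUz, hFiev] with y hy hi
    refine (Gh y).isInvertible_of_nondegenerate fun X hX => ?_
    have h0 : ∀ b, cylFiberMetric G y (cylFrame κ A y X) b = 0 := fun b => by
      obtain ⟨Y, rfl⟩ := hi.surjective b
      rw [← hq y hy, hX]
    apply hi.injective
    rw [map_zero]
    refine Prod.ext ?_ (hnd _ hy _ fun b => ?_)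
    · simpa [cylFiberMetric_apply] using h0 (1, 0)
    · simpa [cylFiberMetric_apply] using h0 (0, b)
  have hdG : DifferentiableAt ℝ G z.2 := (hGat _ hz).differentiableAt two_ne_zero
  have hω := fun X Y W => fderiv_cylConnection (κ := κ) (hAat _ hz) (hGat _ hz) (hGi _ hz) X Y W
  have hR := map_coordCurvature_of_frame (hUz.mono hq) hFc
    (hUz.mono fun y hy => (fderiv_cylFiberMetric (κ := κ) (A := A)
      ((hGat _ hy).differentiableAt two_ne_zero) (hGi _ hy) (hsy _ hy) 0 0 0).1)
    (hω 0 0 0).1 hFiev hGhi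
    (hUz.mono fun y hy a b => by
      rw [cylFiberMetric_apply, cylFiberMetric_apply, hsymm _ hy, mul_comm])
    (hUz.mono fun y hy X a b => (fderiv_cylFiberMetric
      ((hGat _ hy).differentiableAt two_ne_zero) (hGi _ hy) (hsy _ hy) X a b).2)
    (hUz.mono fun y hy X Y => fderiv_cylFrame_add_cylConnection_comm
      ((hAat _ hy).differentiableAt two_ne_zero) ((hGat _ hy).differentiableAt two_ne_zero)
      (hsy _ hy) (hAsymm _ hy) (hCod _ hy) X Y) u v w
  -- by `hR` it remains to compute the curvature of the connection form, in the frame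
  apply hFi.injective
  rw [hR, (hω u v _).2, (hω v u _).2]
  have hΓd := differentiableAt_christoffelCLM (hGat _ hz) (hGi _ hz)
  have hcs := genCos_sq_add κ z.1
  -- Codazzi and Gauss equations at the point under consideration
  have hC := hCod _ hz u.2 v.2
  have hK := hGauss _ hz u.2 v.2 (cylEndo κ A z w.2)
  simp only [coordCovDerivEndo, coordChristoffel_comm hdG (hsy _ hz) v.2 u.2,
    sub_left_inj] at hC
  simp only [coordCurvature, fderiv_christoffelCLM hΓd] at hK
  have hm := fun a b c => fderiv_eq_coordChristoffel hdG (hGi _ hz) (hsy _ hz) a b c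
  have hΓs := coordChristoffel_comm hdG (hsy _ hz) v.2 u.2
  have hBB := cylEndo_comm_symm (κ := κ) (hAsymm _ hz)
  have hs := hsymm _ hz
  -- `∇_u (B' v)` is symmetric in `u` and `v` up to the derivative of `A`
  have hB' : coordChristoffel G z.2 u.2 (cylEndoDeriv κ A z v.2)
      = coordChristoffel G z.2 v.2 (cylEndoDeriv κ A z u.2)
        + genCos κ z.1 • fderiv ℝ A z.2 u.2 v.2 - genCos κ z.1 • fderiv ℝ A z.2 v.2 u.2 := by
    simp only [← christoffelCLM_apply, cylEndoDeriv_apply, map_sub, map_smul] at hC hΓs ⊢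
    rw [hΓs]
    linear_combination (norm := module) (-genCos κ z.1) • hC
  set x := cylEndo κ A z w.2 with hx
  simp only [cylFrame_apply, cylConnection_apply, hm, hGh z hz, hB', map_smul, map_sub,
    christoffelCLM_apply]
  ext
  · simp [← christoffelCLM_apply, ← hx] at hm ⊢
    linear_combination w.1 * hs (cylEndoDeriv κ A z v.2) (cylEndoDeriv κ A z u.2)
  · simp [← christoffelCLM_apply, ← hx] at hK hB' ⊢
    rw [hB']
    clear_value x
    simp only [cylEndo_apply, cylEndoDeriv_apply, map_sub, map_smul, sub_apply, smul_apply,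
      smul_eq_mul]
    -- the coefficients of `A ∧ A` and of `id ∧ id` agree by `cs² + κ sn² = 1`
    linear_combination (norm := module) hK
      - hcs • (G z.2 (A z.2 v.2) x • A z.2 u.2 - G z.2 (A z.2 u.2) x • A z.2 v.2
        + κ • (G z.2 v.2 x • u.2 - G z.2 u.2 x • v.2))

end Cylinder

/-! ### Tensor fields in charts -/

section Charts

open Bundle

variable {E : Type*} [NormedAddCommGroup E] [NormedSpace ℝ E]
  {H : Type*} [TopologicalSpace H] {I : ModelWithCorners ℝ E H} [I.Boundaryless]
  {M : Type*} [TopologicalSpace M] [ChartedSpace H M] [IsManifold I ∞ M]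
  {e : OpenPartialHomeomorph M H}

lemma contMDiffAt_extend_symm_of_mem_atlas (he : e ∈ atlas H M) {y : E}
    (hy : y ∈ (e.extend I).target) : ContMDiffAt 𝓘(ℝ, E) I ∞ (e.extend I).symm y := by
  have h := contMDiffOn_extend_symm (IsManifold.subset_maximalAtlas (I := I) (n := ∞) he)
  rw [I.image_eq, ← e.extend_target] at h
  exact h.contMDiffAt (e.isOpen_extend_target.mem_nhds hy)

omit [I.Boundaryless] [ChartedSpace H M] [IsManifold I ∞ M] in
lemma extend_symm_mem_source {y : E} (hy : y ∈ (e.extend I).target) :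
    (e.extend I).symm y ∈ e.source := by
  have := (e.extend I).map_target hy
  rwa [e.extend_source] at this

omit [I.Boundaryless] in
lemma contMDiffAt_extend_of_mem_atlas (he : e ∈ atlas H M) {y : E}
    (hy : y ∈ (e.extend I).target) :
    ContMDiffAt I 𝓘(ℝ, E) ∞ (e.extend I) ((e.extend I).symm y) :=
  e.contMDiffAt_extend (IsManifold.subset_maximalAtlas he) (extend_symm_mem_source hy)

lemma chartDiff_chartSymmDiff (he : e ∈ atlas H M) {y : E} (hy : y ∈ (e.extend I).target)
    (x : E) : chartDiff I e ((e.extend I).symm y) (chartSymmDiff I e y x) = x := by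
  have h1 := (contMDiffAt_extend_of_mem_atlas he hy).mdifferentiableAt (by simp)
  have h2 := (contMDiffAt_extend_symm_of_mem_atlas he hy).mdifferentiableAt (by simp)
  have h3 : (e.extend I) ∘ (e.extend I).symm =ᶠ[𝓝 y] id :=
    Filter.mem_of_superset (e.isOpen_extend_target.mem_nhds hy) fun z hz =>
      (e.extend I).right_inv hz
  have h4 := mfderiv_comp y h1 h2
  rw [h3.mfderiv_eq, mfderiv_id] at h4
  exact (congrArg (fun L => L x) h4).symm

lemma chartSymmDiff_chartDiff (he : e ∈ atlas H M) {y : E} (hy : y ∈ (e.extend I).target)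
    (v : TangentSpace I ((e.extend I).symm y)) :
    chartSymmDiff I e y (chartDiff I e ((e.extend I).symm y) v) = v := by
  have h1 := (contMDiffAt_extend_of_mem_atlas he hy).mdifferentiableAt (by simp)
  have h2 := (contMDiffAt_extend_symm_of_mem_atlas he hy).mdifferentiableAt (by simp)
  have h3 : (e.extend I).symm ∘ (e.extend I) =ᶠ[𝓝 ((e.extend I).symm y)] id :=
    Filter.mem_of_superset (e.open_source.mem_nhds (extend_symm_mem_source hy)) fun z hz =>
      e.extend_left_inv hz
  have h4 := mfderiv_comp_of_eq h2 h1 ((e.extend I).right_inv hy)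
  rw [h3.mfderiv_eq, mfderiv_id] at h4
  -- `mfderiv` at `φ (φ⁻¹ y)` and at `y` have propositionally equal, but distinct, types
  have h5 : ∀ z, z = y → ∀ w : E,
      (id (mfderiv 𝓘(ℝ, E) I (e.extend I).symm z w) : E) = chartSymmDiff I e y w := by
    rintro _ rfl w
    rfl
  exact (h5 _ ((e.extend I).right_inv hy) _).symm.trans (congrArg (fun L => L v) h4).symm

omit [I.Boundaryless] [ChartedSpace H M] [IsManifold I ∞ M] in
/-- Points of the domain of a chart are described by their coordinates. -/
lemma exists_extend_symm_eq {p : M} (hp : p ∈ e.source) :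
    ∃ y ∈ (e.extend I).target, (e.extend I).symm y = p :=
  ⟨e.extend I p, (e.extend I).map_source (by rwa [e.extend_source]), e.extend_left_inv hp⟩

lemma chartLift_eq (he : e ∈ atlas H M) {y : E} (hy : y ∈ (e.extend I).target) (x : E) :
    chartLift I e ((e.extend I).symm y) x = chartSymmDiff I e y x := by
  have : (chartDiff I e ((e.extend I).symm y)).IsInvertible :=
    ContinuousLinearMap.IsInvertible.of_inverse (g := chartSymmDiff I e y)
      (by ext x; exact chartDiff_chartSymmDiff he hy x)
      (by ext x; exact chartSymmDiff_chartDiff he hy x)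
  rw [chartLift, this.inverse_apply_eq, chartDiff_chartSymmDiff he hy]

/-- The coordinate vector fields of a chart are smooth. -/
lemma contMDiffAt_chartSymmDiff (he : e ∈ atlas H M) {y : E} (hy : y ∈ (e.extend I).target)
    (a : E) : ContMDiffAt 𝓘(ℝ, E) (I.prod 𝓘(ℝ, E)) ∞
      (fun z => TotalSpace.mk' E (E := (TangentSpace I : M → Type _)) ((e.extend I).symm z)
        (chartSymmDiff I e z a)) y := by
  have hT := e.isOpen_extend_target (I := I)
  have h := contMDiffOn_extend_symm (IsManifold.subset_maximalAtlas (I := I) (n := ∞) he)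
  rw [I.image_eq, ← e.extend_target] at h
  have h1 := h.contMDiffOn_tangentMapWithin (m := ∞) le_rfl hT.uniqueMDiffOn
  have h2 : ContMDiff 𝓘(ℝ, E) (𝓘(ℝ, E).prod 𝓘(ℝ, E)) ∞
      (fun z : E => (TotalSpace.mk' E z a : TangentBundle 𝓘(ℝ, E) E)) :=
    contMDiff_vectorSpace_iff_contDiff.2 contDiff_const
  have h3 := (h1.comp h2.contMDiffOn (s := (e.extend I).target) (fun z hz => hz)).contMDiffAt
    (hT.mem_nhds hy)
  refine h3.congr_of_eventuallyEq ?_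
  filter_upwards [hT.mem_nhds hy] with z hz
  simp only [Function.comp_apply, tangentMapWithin, mfderivWithin_of_isOpen hT hz]
  rfl

/-- At the point with coordinates `y`, the two base points `y` and `φ (φ⁻¹ y)` occurring in
`riemannCurvature` are identified, and `chartLift` becomes the differential of `φ⁻¹`. -/
lemma riemannCurvature_eq_chartSymmDiff (g : BilinField I M) (he : e ∈ atlas H M) {y : E}
    (hy : y ∈ (e.extend I).target) (u v w : TangentSpace I ((e.extend I).symm y)) :
    riemannCurvature g e ((e.extend I).symm y) u v w
      = chartSymmDiff I e y (coordCurvature (g.inChart e) y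
          (chartDiff I e ((e.extend I).symm y) u) (chartDiff I e ((e.extend I).symm y) v)
          (chartDiff I e ((e.extend I).symm y) w)) := by
  rw [riemannCurvature, chartLift_eq he hy, (e.extend I).right_inv hy]

lemma covDerivEndo_eq_chartSymmDiff (g : BilinField I M) (A : EndoField I M)
    (he : e ∈ atlas H M) {y : E}
    (hy : y ∈ (e.extend I).target) (u v : TangentSpace I ((e.extend I).symm y)) :
    covDerivEndo g A e ((e.extend I).symm y) u v
      = chartSymmDiff I e y (coordCovDerivEndo (g.inChart e) (A.inChart e) y
          (chartDiff I e ((e.extend I).symm y) u) (chartDiff I e ((e.extend I).symm y) v)) := by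
  rw [covDerivEndo, chartLift_eq he hy, (e.extend I).right_inv hy]

lemma chartSymmDiff_injective (he : e ∈ atlas H M) {y : E} (hy : y ∈ (e.extend I).target) :
    Function.Injective (chartSymmDiff I e y) :=
  Function.LeftInverse.injective fun x => chartDiff_chartSymmDiff he hy x

omit [I.Boundaryless] [IsManifold I ∞ M] in
lemma BilinField.inChart_apply (g : BilinField I M) (y u v : E) :
    g.inChart e y u v
      = g ((e.extend I).symm y) (chartSymmDiff I e y u) (chartSymmDiff I e y v) := rfl

lemma EndoField.chartSymmDiff_inChart (A : EndoField I M) (he : e ∈ atlas H M) {y : E}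
    (hy : y ∈ (e.extend I).target) (v : E) :
    chartSymmDiff I e y (A.inChart e y v)
      = A ((e.extend I).symm y) (chartSymmDiff I e y v) :=
  chartSymmDiff_chartDiff he hy _

/-- A smooth metric has smooth coefficients in every chart of the atlas. In finite dimension it
suffices to evaluate on coordinate fields. -/
lemma BilinField.contDiffOn_inChart [FiniteDimensional ℝ E] {g : BilinField I M}
    (hg : IsSemiRiemannianMetricOn g Set.univ) (he : e ∈ atlas H M) :
    ContDiffOn ℝ ∞ (g.inChart e) (e.extend I).target := by
  refine contDiffOn_clm_apply.2 fun a => contDiffOn_clm_apply.2 fun b y hy => ?_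
  have h1 : ContMDiffAt 𝓘(ℝ, E) (I.prod 𝓘(ℝ, E →L[ℝ] E →L[ℝ] ℝ)) ∞
      (fun z => TotalSpace.mk' (E →L[ℝ] E →L[ℝ] ℝ)
        (E := fun p : M => TangentSpace I p →L[ℝ] TangentSpace I p →L[ℝ] ℝ)
        ((e.extend I).symm z) (g ((e.extend I).symm z))) y :=
    (hg.smooth.contMDiffAt Filter.univ_mem).comp y (contMDiffAt_extend_symm_of_mem_atlas he hy)
  have h2 := h1.clm_bundle_apply₂ (F₁ := E) (F₂ := E) (E₃ := Bundle.Trivial M ℝ)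
    (contMDiffAt_chartSymmDiff he hy a) (contMDiffAt_chartSymmDiff he hy b)
  rw [contMDiffAt_totalSpace] at h2
  exact (h2.2.contDiffAt).contDiffWithinAt

/-- A smooth endomorphism field has smooth coefficients in every chart of the atlas. -/
lemma EndoField.contDiffOn_inChart [FiniteDimensional ℝ E] {g : BilinField I M}
    {A : EndoField I M} (hA : IsSymmetricEndoField g A) (he : e ∈ atlas H M) :
    ContDiffOn ℝ ∞ (A.inChart e) (e.extend I).target := by
  refine contDiffOn_clm_apply.2 fun a y hy => ?_
  have h1 : ContMDiffAt 𝓘(ℝ, E) (I.prod 𝓘(ℝ, E →L[ℝ] E)) ∞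
      (fun z => TotalSpace.mk' (E →L[ℝ] E)
        (E := fun p : M => TangentSpace I p →L[ℝ] TangentSpace I p)
        ((e.extend I).symm z) (A ((e.extend I).symm z))) y :=
    (hA.smooth.contMDiffAt).comp y (contMDiffAt_extend_symm_of_mem_atlas he hy)
  have h2 := h1.clm_bundle_apply (F₁ := E) (F₂ := E) (contMDiffAt_chartSymmDiff he hy a)
  have h3 := (e.contMDiffOn_extend (IsManifold.subset_maximalAtlas (I := I) (n := ∞)
    he)).contMDiffOn_tangentMapWithin (m := ∞) le_rfl e.open_source.uniqueMDiffOn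
  have h4 := (h3.contMDiffAt ((e.open_source.preimage
    (FiberBundle.continuous_proj E (TangentSpace I))).mem_nhds
      (extend_symm_mem_source hy))).comp y h2
  rw [contMDiffAt_totalSpace] at h4
  refine (h4.2.contDiffAt.congr_of_eventuallyEq ?_).contDiffWithinAt
  filter_upwards [e.isOpen_extend_target.mem_nhds hy] with z hz
  simp only [Function.comp_apply, tangentMapWithin,
    mfderivWithin_of_isOpen e.open_source (extend_symm_mem_source hz)]
  simp
  rfl

end Charts

/-! ### Charts of the cylinder -/

section Cylinder

open Bundle

variable {E : Type*} [NormedAddCommGroup E] [NormedSpace ℝ E]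
  {H : Type*} [TopologicalSpace H] {I : ModelWithCorners ℝ E H} [I.Boundaryless]
  {M : Type*} [TopologicalSpace M] [ChartedSpace H M] [IsManifold I ∞ M]
  {e : OpenPartialHomeomorph M H}

/-- A field of bilinear forms which is smooth in the preferred chart at `p` is smooth at `p` as a
section. -/
lemma BilinField.contMDiffAt_of_inChart {h : BilinField I M} {p : M}
    (hs : ContDiffAt ℝ ∞ (h.inChart (chartAt H p)) (extChartAt I p p)) :
    ContMDiffAt I (I.prod 𝓘(ℝ, E →L[ℝ] E →L[ℝ] ℝ)) ∞
      (fun q => TotalSpace.mk' (E →L[ℝ] E →L[ℝ] ℝ)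
        (E := fun q : M => TangentSpace I q →L[ℝ] TangentSpace I q →L[ℝ] ℝ) q (h q)) p := by
  rw [contMDiffAt_hom_bundle]
  refine ⟨contMDiffAt_id, ?_⟩
  refine ((hs.contMDiffAt).comp p (contMDiffAt_extChartAt (n := ∞))).congr_of_eventuallyEq ?_
  filter_upwards [(chartAt H p).open_source.mem_nhds (mem_chart_source H p)] with q hq
  have hb : q ∈ (trivializationAt E (TangentSpace I) p).baseSet := by simpa using hq
  have hsymm : ∀ a : E, (trivializationAt E (TangentSpace I) p).symm q a
      = (id (chartSymmDiff I (chartAt H p) (extChartAt I p q) a) : E) := fun a => by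
    have h1 := congrArg (fun L => L a) (TangentBundle.symmL_trivializationAt (I := I) hq)
    rw [I.range_eq_univ, mfderivWithin_univ] at h1
    exact ((trivializationAt E (TangentSpace I) p).symmL_apply (R := ℝ) hb a).symm.trans h1
  -- transport from the base point `φ⁻¹ (φ q)` to `q`
  have hq' : ∀ q', q' = q → ∀ a b : E, h q' a b = h q a b := by rintro _ rfl a b; rfl
  ext a b
  rw [inCoordinates_apply_eq₂ hb hb (by simp)]
  simp only [hsymm, Trivial.fiberBundle_trivializationAt', Trivial.linearMapAt_trivialization,
    LinearMap.id_coe, id_eq]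
  exact (hq' _ ((chartAt H p).extend_left_inv (I := I) hq) _ _).symm

/-- The product of the identity chart of `ℝ` with the chart `e` of `M`. -/
def cylChart (e : OpenPartialHomeomorph M H) : OpenPartialHomeomorph (ℝ × M) (ModelProd ℝ H) :=
  (OpenPartialHomeomorph.refl ℝ).prod e

omit [I.Boundaryless] [IsManifold I ∞ M] in
/-- `ℝ` has only its identity chart, so every chart of `ℝ × M` in the atlas is a `cylChart`. -/
lemma exists_eq_cylChart {e' : OpenPartialHomeomorph (ℝ × M) (ModelProd ℝ H)}
    (he' : e' ∈ atlas (ModelProd ℝ H) (ℝ × M)) : ∃ e ∈ atlas H M, e' = cylChart e := by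
  obtain ⟨e₀, h₀, e, he, rfl⟩ := he'
  rw [chartedSpaceSelf_atlas] at h₀
  exact ⟨e, he, by rw [h₀, cylChart]⟩

omit [I.Boundaryless] [ChartedSpace H M] [IsManifold I ∞ M] in
lemma mem_cylChart_extend_target {z : ℝ × E} :
    z ∈ ((cylChart e).extend (𝓘(ℝ, ℝ).prod I)).target ↔ z.2 ∈ (e.extend I).target := by
  rw [cylChart, OpenPartialHomeomorph.extend_prod, PartialEquiv.prod_target, Set.mem_prod]
  simp

lemma chartSymmDiff_cylChart (he : e ∈ atlas H M) {z : ℝ × E}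
    (hz : z.2 ∈ (e.extend I).target) (X : ℝ × E) :
    chartSymmDiff (𝓘(ℝ, ℝ).prod I) (cylChart e) z X = (X.1, chartSymmDiff I e z.2 X.2) := by
  have h2 := (contMDiffAt_extend_symm_of_mem_atlas he hz).mdifferentiableAt (by simp)
  have h1 : MDifferentiableAt 𝓘(ℝ, ℝ) 𝓘(ℝ, ℝ) (id : ℝ → ℝ) z.1 := mdifferentiableAt_id
  have h3 := mfderiv_prodMap (p := z) h1 h2
  rw [mfderiv_id] at h3
  have h6 : chartSymmDiff (𝓘(ℝ, ℝ).prod I) (cylChart e) z = mfderiv (𝓘(ℝ, ℝ).prod 𝓘(ℝ, E))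
    (𝓘(ℝ, ℝ).prod I) (Prod.map id (e.extend I).symm) z := by
    unfold chartSymmDiff
    rw [modelWithCornersSelf_prod, chartedSpaceSelf_prod]
    rfl
  have h4 := congrArg (fun L => L X) h3
  exact (congrArg (fun L => L X) h6).trans h4

omit [I.Boundaryless] [IsManifold I ∞ M] in
lemma cylinderMetric_sliceMetric_apply (g : BilinField I M) (A : EndoField I M) (κ : ℝ)
    (x : ℝ × M) (X Y : ℝ × E) :
    cylinderMetric (sliceMetric g A κ) x X Y = X.1 * Y.1
      + g x.2 ((genCos κ x.1 • ContinuousLinearMap.id ℝ (TangentSpace I x.2)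
        - genSin κ x.1 • A x.2) ((genCos κ x.1 • ContinuousLinearMap.id ℝ (TangentSpace I x.2)
        - genSin κ x.1 • A x.2) X.2)) Y.2 := rfl

omit [I.Boundaryless] [IsManifold I ∞ M] in
/-- The endomorphism `cs_κ(t) id - sn_κ(t) A` is symmetric. -/
lemma metric_cylEndo_symm {g : BilinField I M} {A : EndoField I M} {p : M}
    (hA : ∀ v w : TangentSpace I p, g p (A p v) w = g p v (A p w)) (c s : ℝ)
    (v w : TangentSpace I p) :
    g p ((c • ContinuousLinearMap.id ℝ (TangentSpace I p) - s • A p) v) w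
      = g p v ((c • ContinuousLinearMap.id ℝ (TangentSpace I p) - s • A p) w) := by
  simp [hA]

/-- `cylEndo` is the coordinate expression of `cs_κ(t) id - sn_κ(t) A`. -/
lemma chartSymmDiff_cylEndo (κ : ℝ) (A : EndoField I M) (he : e ∈ atlas H M) {z : ℝ × E}
    (hz : z.2 ∈ (e.extend I).target) (v : E) :
    chartSymmDiff I e z.2 (cylEndo κ (A.inChart e) z v)
      = (genCos κ z.1 • ContinuousLinearMap.id ℝ (TangentSpace I ((e.extend I).symm z.2))
        - genSin κ z.1 • A ((e.extend I).symm z.2)) (chartSymmDiff I e z.2 v) := by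
  rw [cylEndo_apply, map_sub, map_smul, map_smul, A.chartSymmDiff_inChart he hz]
  rfl

/-- In a chart, the cylinder metric is the pullback of `dt² + g` by `cylFrame`. -/
lemma cylinderMetric_inChart {g : BilinField I M} {A : EndoField I M} (κ : ℝ)
    (hA : ∀ (p : M) (v w : TangentSpace I p), g p (A p v) w = g p v (A p w))
    (he : e ∈ atlas H M) {z : ℝ × E} (hz : z.2 ∈ (e.extend I).target) (X Y : ℝ × E) :
    (cylinderMetric (sliceMetric g A κ)).inChart (cylChart e) z X Y = X.1 * Y.1
      + g.inChart e z.2 (cylEndo κ (A.inChart e) z X.2) (cylEndo κ (A.inChart e) z Y.2) := by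
  rw [BilinField.inChart_apply, chartSymmDiff_cylChart he hz, chartSymmDiff_cylChart he hz]
  refine (cylinderMetric_sliceMetric_apply g A κ _ _ _).trans ?_
  rw [BilinField.inChart_apply, chartSymmDiff_cylEndo κ A he hz, chartSymmDiff_cylEndo κ A he hz,
    ← metric_cylEndo_symm (hA _)]
  rfl

end Cylinder

/-! ### Nondegeneracy, smoothness and curvature of the cylinder metric -/

section ConstantCurvature

variable {E : Type*} [NormedAddCommGroup E] [NormedSpace ℝ E]
  {H : Type*} [TopologicalSpace H] {I : ModelWithCorners ℝ E H}
  {M : Type*} [TopologicalSpace M] [ChartedSpace H M]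
  {e : OpenPartialHomeomorph M H} {g : BilinField I M} {A : EndoField I M} {κ : ℝ}

/-- `dt² + g_t` is nondegenerate exactly where `B = cs_κ(t) id - sn_κ(t) A` is injective: `g` is
nondegenerate, and `B²` is injective if and only if `B` is. -/
lemma mem_nondegenerateLocus_cylinderMetric_iff [IsManifold I 1 M]
    (hg : IsSemiRiemannianMetricOn g Set.univ) (x : ℝ × M) :
    x ∈ (cylinderMetric (sliceMetric g A κ)).nondegenerateLocus ↔
      ∀ v : TangentSpace I x.2, (genCos κ x.1 • ContinuousLinearMap.id ℝ (TangentSpace I x.2)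
        - genSin κ x.1 • A x.2) v = 0 → v = 0 := by
  set B := genCos κ x.1 • ContinuousLinearMap.id ℝ (TangentSpace I x.2) - genSin κ x.1 • A x.2
    with hB
  have happ : ∀ X Y : ℝ × E, cylinderMetric (sliceMetric g A κ) x X Y
      = X.1 * Y.1 + g x.2 (B (B X.2)) Y.2 := cylinderMetric_sliceMetric_apply g A κ x
  constructor
  · intro hx v hv
    have h0 : ∀ w, g x.2 (B (B v)) w = 0 := fun w => by simp [hv]
    have h := hx ((0, v) : ℝ × E) fun Y => (happ _ _).trans
      ((congrArg₂ (· + ·) (zero_mul _) (h0 _)).trans (add_zero 0))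
    exact congrArg Prod.snd h
  · intro h X hX
    have h1 : X.1 = 0 := by
      have h0 : X.1 * 1 + g x.2 (B (B X.2)) (0 : TangentSpace I x.2) = 0 :=
        (happ X (1, 0)).symm.trans (hX ((1, 0) : ℝ × E))
      rwa [map_zero, mul_one, add_zero] at h0
    have h2 : B (B X.2) = 0 := hg.nondegenerate (Set.mem_univ x.2) _ fun w => by
      have h0 : X.1 * 0 + g x.2 (B (B X.2)) w = 0 :=
        (happ X (0, w)).symm.trans (hX ((0, w) : ℝ × E))
      rwa [mul_zero, zero_add] at h0
    exact Prod.ext h1 (h _ (h _ h2))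

variable [I.Boundaryless] [IsManifold I ∞ M]

lemma mem_nondegenerateLocus_cylinderMetric_iff_cylEndo
    (hg : IsSemiRiemannianMetricOn g Set.univ) (he : e ∈ atlas H M) {z : ℝ × E} (hz : z.2 ∈ (e.extend I).target) :
    (z.1, (e.extend I).symm z.2) ∈ (cylinderMetric (sliceMetric g A κ)).nondegenerateLocus ↔
      ∀ v, cylEndo κ (A.inChart e) z v = 0 → v = 0 := by
  rw [mem_nondegenerateLocus_cylinderMetric_iff hg]
  have hinj := chartSymmDiff_injective (I := I) he hz
  constructor
  · intro h v hv
    apply hinj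
    rw [map_zero]
    refine h _ ?_
    rw [← chartSymmDiff_cylEndo κ A he hz, hv, map_zero]
  · intro h v hv
    have h1 := chartSymmDiff_chartDiff he hz v
    rw [← h1] at hv ⊢
    rw [← chartSymmDiff_cylEndo κ A he hz] at hv
    rw [h _ (hinj (hv.trans (map_zero _).symm)), map_zero]

lemma SatisfiesCodazzi.inChart (h : SatisfiesCodazzi g A) (he : e ∈ atlas H M) {y : E}
    (hy : y ∈ (e.extend I).target) (u v : E) :
    coordCovDerivEndo (g.inChart e) (A.inChart e) y u v
      = coordCovDerivEndo (g.inChart e) (A.inChart e) y v u := by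
  have h1 := h e he _ (extend_symm_mem_source hy) (chartSymmDiff I e y u) (chartSymmDiff I e y v)
  rw [covDerivEndo_eq_chartSymmDiff g A he hy, covDerivEndo_eq_chartSymmDiff g A he hy,
    chartDiff_chartSymmDiff he hy, chartDiff_chartSymmDiff he hy] at h1
  exact chartSymmDiff_injective he hy h1

lemma SatisfiesGauss.inChart (h : SatisfiesGauss g A κ) (he : e ∈ atlas H M) {y : E}
    (hy : y ∈ (e.extend I).target) (u v w : E) :
    coordCurvature (g.inChart e) y u v w
      = g.inChart e y (A.inChart e y v) w • A.inChart e y u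
        - g.inChart e y (A.inChart e y u) w • A.inChart e y v
        + κ • (g.inChart e y v w • u - g.inChart e y u w • v) := by
  have h1 := h e he _ (extend_symm_mem_source hy) (chartSymmDiff I e y u) (chartSymmDiff I e y v)
    (chartSymmDiff I e y w)
  rw [riemannCurvature_eq_chartSymmDiff g he hy, chartDiff_chartSymmDiff he hy,
    chartDiff_chartSymmDiff he hy, chartDiff_chartSymmDiff he hy] at h1
  apply chartSymmDiff_injective he hy
  rw [h1]
  simp only [map_add, map_sub, map_smul, BilinField.inChart_apply,
    A.chartSymmDiff_inChart he hy]

variable [FiniteDimensional ℝ E]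

/-- `dt² + g_t` is smooth also where it is degenerate. -/
lemma contMDiffAt_cylinderMetric (κ : ℝ) (hg : IsSemiRiemannianMetricOn g Set.univ)
    (hA : IsSymmetricEndoField g A) (x : ℝ × M) :
    ContMDiffAt (𝓘(ℝ, ℝ).prod I)
      ((𝓘(ℝ, ℝ).prod I).prod 𝓘(ℝ, ℝ × E →L[ℝ] ℝ × E →L[ℝ] ℝ)) ∞
      (fun q => Bundle.TotalSpace.mk' (ℝ × E →L[ℝ] ℝ × E →L[ℝ] ℝ)
        (E := fun q : ℝ × M => TangentSpace (𝓘(ℝ, ℝ).prod I) q →L[ℝ]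
          TangentSpace (𝓘(ℝ, ℝ).prod I) q →L[ℝ] ℝ) q (cylinderMetric (sliceMetric g A κ) q)) x := by
  refine BilinField.contMDiffAt_of_inChart ?_
  have hc : chartAt (ModelProd ℝ H) x = cylChart (chartAt H x.2) := rfl
  have he := chart_mem_atlas H x.2
  rw [extChartAt, hc]
  have hx : (cylChart (chartAt H x.2)).extend (𝓘(ℝ, ℝ).prod I) x
      ∈ ((cylChart (chartAt H x.2)).extend (𝓘(ℝ, ℝ).prod I)).target := mem_extChartAt_target x
  have ho := (cylChart (chartAt H x.2)).isOpen_extend_target (I := 𝓘(ℝ, ℝ).prod I)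
  refine ContDiffOn.contDiffAt ?_ (ho.mem_nhds hx)
  refine contDiffOn_clm_apply.2 fun X => contDiffOn_clm_apply.2 fun Y => ?_
  refine ContDiffOn.congr (f := fun z => X.1 * Y.1 + g.inChart (chartAt H x.2) z.2
    (cylEndo κ (A.inChart (chartAt H x.2)) z X.2)
    (cylEndo κ (A.inChart (chartAt H x.2)) z Y.2)) ?_ fun z hz =>
    cylinderMetric_inChart κ hA.symm he (mem_cylChart_extend_target.1 hz) X Y
  intro z hz
  rw [mem_cylChart_extend_target] at hz
  have hT := (chartAt H x.2).isOpen_extend_target (I := I)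
  have hG := (BilinField.contDiffOn_inChart hg he).contDiffAt (hT.mem_nhds hz)
  have hB := contDiffAt_cylEndo κ (n := ⊤)
    ((EndoField.contDiffOn_inChart hA he).contDiffAt (hT.mem_nhds hz))
  exact (contDiffAt_const.add (((hG.comp z contDiffAt_snd).clm_apply
    (hB.clm_apply contDiffAt_const)).clm_apply
      (hB.clm_apply contDiffAt_const))).contDiffWithinAt

lemma isOpen_nondegenerateLocus_cylinderMetric (κ : ℝ)
    (hg : IsSemiRiemannianMetricOn g Set.univ) (hA : IsSymmetricEndoField g A) :
    IsOpen (cylinderMetric (sliceMetric g A κ)).nondegenerateLocus := by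
  rw [isOpen_iff_mem_nhds]
  rintro ⟨t, p⟩ hx
  set e := chartAt H p
  have he : e ∈ atlas H M := chart_mem_atlas H p
  have hT := e.isOpen_extend_target (I := I)
  have hmem : ∀ q ∈ e.source, e.extend I q ∈ (e.extend I).target := fun q hq =>
    (e.extend I).map_source (by rwa [e.extend_source])
  -- near `p`, membership in the locus means injectivity of `cylEndo`, which is an open condition
  have hiff : ∀ (s : ℝ), ∀ q ∈ e.source,
      ((s, q) ∈ (cylinderMetric (sliceMetric g A κ)).nondegenerateLocus ↔
        ∀ v, cylEndo κ (A.inChart e) (s, e.extend I q) v = 0 → v = 0) := fun s q hq => by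
    rw [← mem_nondegenerateLocus_cylinderMetric_iff_cylEndo hg he (hmem q hq),
      e.extend_left_inv hq]
  have hp : p ∈ e.source := mem_chart_source H p
  have hinv := (cylEndo κ (A.inChart e) (t, e.extend I p)).isInvertible_of_finrank_eq
    ((hiff t p hp).1 hx) rfl
  have hev := hinv.eventually (contDiffAt_cylEndo κ (n := ⊤)
    ((EndoField.contDiffOn_inChart hA he).contDiffAt (hT.mem_nhds (hmem p hp)))).continuousAt
  have hcont : ContinuousAt (fun q : ℝ × M => (q.1, e.extend I q.2)) (t, p) :=
    continuousAt_fst.prodMk ((e.continuousAt_extend hp).comp continuousAt_snd)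
  filter_upwards [hcont.eventually hev,
    continuousAt_snd.eventually (e.open_source.mem_nhds hp)] with q hq hqs
  exact (hiff q.1 q.2 hqs).2 fun v hv => hq.injective (hv.trans (map_zero _).symm)

lemma hasConstantCurvatureTensorOn_cylinderMetric
    (hg : IsSemiRiemannianMetricOn g Set.univ) (hA : IsSymmetricEndoField g A)
    (hCodazzi : SatisfiesCodazzi g A) (hGauss : SatisfiesGauss g A κ) :
    HasConstantCurvatureTensorOn (cylinderMetric (sliceMetric g A κ)) κ
      (cylinderMetric (sliceMetric g A κ)).nondegenerateLocus := by
  intro e' he' x hx X Y Z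
  obtain ⟨e, he, rfl⟩ := exists_eq_cylChart he'
  obtain ⟨z, hz', rfl⟩ := exists_extend_symm_eq (I := 𝓘(ℝ, ℝ).prod I) hx.1
  have hz := mem_cylChart_extend_target.1 hz'
  have hB := (mem_nondegenerateLocus_cylinderMetric_iff_cylEndo hg he hz).1 hx.2
  rw [riemannCurvature_eq_chartSymmDiff _ he' hz']
  have h2 : (2 : WithTop ℕ∞) ≤ ∞ := WithTop.coe_le_coe.2 (le_top : (2 : ℕ∞) ≤ ⊤)
  rw [coordCurvature_cylinder (κ := κ) (e.isOpen_extend_target (I := I))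
    ((BilinField.contDiffOn_inChart hg he).of_le h2)
    ((EndoField.contDiffOn_inChart hA he).of_le h2)
    (fun y hy u v => hg.symm _ (Set.mem_univ _) _ _)
    (fun y hy v hv => ?_)
    (fun y hy v w => ?_)
    (fun y hy u v => hCodazzi.inChart he hy u v)
    (fun y hy u v w => hGauss.inChart he hy u v w)
    (fun z hz X Y => cylinderMetric_inChart κ hA.symm he hz X Y) hz hB]
  · rw [map_smul, map_sub, map_smul, map_smul, BilinField.inChart_apply,
      BilinField.inChart_apply, chartSymmDiff_chartDiff he' hz', chartSymmDiff_chartDiff he' hz',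
      chartSymmDiff_chartDiff he' hz']
  · apply chartSymmDiff_injective (I := I) he hy
    rw [map_zero]
    refine hg.nondegenerate (Set.mem_univ _) _ fun w => ?_
    rw [← chartSymmDiff_chartDiff he hy w]
    exact hv _
  · rw [BilinField.inChart_apply, BilinField.inChart_apply, A.chartSymmDiff_inChart he hy,
      A.chartSymmDiff_inChart he hy, hA.symm]

omit [I.Boundaryless] [IsManifold I ∞ M] [FiniteDimensional ℝ E] in
/-- A curvature tensor of constant-curvature form gives constant sectional curvature. -/
lemma HasConstantCurvatureTensorOn.hasConstantSectionalCurvatureOn {s : Set M}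
    (h : HasConstantCurvatureTensorOn g κ s) (hs : ∀ p ∈ s, ∀ v w, g p v w = g p w v) :
    HasConstantSectionalCurvatureOn g κ s := by
  intro e he p hp u v huv
  rw [sectionalCurvature, h e he p hp, div_eq_iff huv]
  simp only [map_smul, map_sub, sub_apply, smul_apply, smul_eq_mul, hs p hp.2 v u]
  ring

end ConstantCurvature

theorem mainTheorem1 {E : Type*} [NormedAddCommGroup E] [NormedSpace ℝ E] [FiniteDimensional ℝ E]
    {H : Type*} [TopologicalSpace H] (I : ModelWithCorners ℝ E H) [I.Boundaryless]
    {M : Type*} [TopologicalSpace M] [ChartedSpace H M] [IsManifold I ∞ M]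
    (g : BilinField I M) (hg : IsSemiRiemannianMetricOn g Set.univ)
    (κ : ℝ) (A : EndoField I M) (hA : IsSymmetricEndoField g A)
    (hCodazzi : SatisfiesCodazzi g A) (hGauss : SatisfiesGauss g A κ) :
    let gZ : BilinField (𝓘(ℝ, ℝ).prod I) (ℝ × M) := cylinderMetric (sliceMetric g A κ)
    let D : Set (ℝ × M) := gZ.nondegenerateLocus
    IsOpen D ∧ (∀ p : M, ((0 : ℝ), p) ∈ D) ∧
      IsSemiRiemannianMetricOn gZ D ∧
      HasConstantSectionalCurvatureOn gZ κ D ∧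
      HasConstantCurvatureTensorOn gZ κ D := by
  intro gZ D
  have hsymm : ∀ x, ∀ v w, gZ x v w = gZ x w v := fun x v w => by
    have hB := metric_cylEndo_symm (hA.symm x.2) (genCos κ x.1) (genSin κ x.1)
    refine (cylinderMetric_sliceMetric_apply g A κ x v w).trans
      (Eq.trans (congrArg₂ (· + ·) (mul_comm _ _) ?_)
        (cylinderMetric_sliceMetric_apply g A κ x w v).symm)
    exact ((hB _ _).trans (hB _ _)).trans (hg.symm x.2 (Set.mem_univ _) _ _)
  have hR := hasConstantCurvatureTensorOn_cylinderMetric hg hA hCodazzi hGauss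
  refine ⟨isOpen_nondegenerateLocus_cylinderMetric κ hg hA, fun p => ?_,
    ⟨fun x _ => hsymm x, subset_rfl,
      fun x _ => (contMDiffAt_cylinderMetric κ hg hA x).contMDiffWithinAt⟩,
    hR.hasConstantSectionalCurvatureOn fun x _ => hsymm x, hR⟩
  refine (mem_nondegenerateLocus_cylinderMetric_iff hg _).2 fun v hv => ?_
  simpa [genCos_zero, genSin_zero] using hv
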